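/- All rings are commutative with one. A ring homomorphism $A\to B$ is called crisp (pure) if $P\to B\otimes_A P$ is injective for every $A$-module $P$. A surjective morphism $f\colon X\to Y$ of quasi-separated schemes is called crisp if every quasi-compact open subset of $Y$ is the image of a quasi-compact open subset of $X$, and there is an affine open covering $(V_j)_{j\in J}$ of $Y$ such that for every $j$ there are a quasi-compact open $U_j\subseteq f^{-1}(V_j)$ with $f(U_j)=V_j$ and a finite affine open covering $U_{j,1},\dots,U_{j,r_j}$ of $U_j$ for which the ring homomorphism $\mathcal{O}_Y(V_j)\to\prod_{i=1}^{r_j}\mathcal{O}_X(U_{j,i})$ corresponding to $\bigsqcup_{i=1}^{r_j}U_{j,i}\to V_j$ is crisp. A morphism of schemes is called submersive if it is surjective and its target carries the quotient topology. The constructible topology on a scheme is the topology whose open sets are the ind-constructible subsets, i.e. the subsets that are locally (on every affine open subscheme) unions of constructible subsets. A morphism of schemes $f\colon X\to Y$ is called subtrusive if (a) for all points $y,y'\in Y$ such that $y'$ is a specialisation of $y$ there are points $x,x'\in X$ such that $x'$ is a specialisation of $x$, $f(x)=y$ and $f(x')=y'$, and (b) $f$ is surjective and $Y$ carries the quotient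 topology with respect to $f$ when $X$ and $Y$ are given their constructible topologies. A morphism has one of these properties universally if for every morphism of schemes $Y'\to Y$ the base change $X\times_Y Y'\to Y'$ has it. Proposition. Let $f\colon X\to Y$ be a quasi-compact crisp morphism of (quasi-separated) schemes. Then $f$ is universally subtrusive; in particular, $f$ is universally submersive. -/

import Mathlib

open CategoryTheory AlgebraicGeometry Topology
open scoped TensorProduct Set.Notation

universe u

namespace Crisp

/-- A linear map `φ : M → N` of `A`-modules is crisp (pure, universally injective) if
`φ ⊗ id_P : M ⊗ P → N ⊗ P` is injective for all `A`-modules `P`. -/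
def LinearMapIsCrisp {A M N : Type u} [CommRing A] [AddCommGroup M] [AddCommGroup N]
    [Module A M] [Module A N] (φ : M →ₗ[A] N) : Prop :=
  ∀ (P : Type u) [AddCommGroup P] [Module A P], Function.Injective (φ.rTensor P)

/-- A ring homomorphism `A → B` is crisp if it is crisp as a map of `A`-modules. -/
def RingHomIsCrisp {A B : Type u} [CommRing A] [CommRing B] (φ : A →+* B) : Prop :=
  letI := φ.toAlgebra
  LinearMapIsCrisp (Algebra.linearMap A B)

variable {X Y : Scheme.{u}}

/-- A surjective morphism `f : X ⟶ Y` is locally quasi-compact surjective if every quasi-compact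
open of `Y` is the image of a quasi-compact open of `X`. -/
structure IsLocallyQuasiCompactSurjective (f : X ⟶ Y) : Prop where
  surjective : Function.Surjective f
  exists_image_eq : ∀ V : Y.Opens, IsCompact (V : Set Y) →
    ∃ U : X.Opens, IsCompact (U : Set X) ∧ f '' (U : Set X) = (V : Set Y)

/-- For opens `U₁, …, U_r ⊆ f⁻¹(V)`, the ring homomorphism `Γ(V) → ∏ i, Γ(U_i) = Γ(∐ i, U_i)`
corresponding to the morphism `∐ i, U_i ⟶ V` from the disjoint union of the `U_i`. -/
noncomputable def sectionsMap (f : X ⟶ Y) (V : Y.Opens) {r : ℕ} (U : Fin r → X.Opens)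
    (h : ∀ i, U i ≤ f ⁻¹ᵁ V) : Γ(Y, V) →+* (∀ i, Γ(X, U i)) :=
  RingHom.pi fun i ↦ (f.appLE V (U i) (h i)).hom

/-- Crispness of `f` over an affine open `V ⊆ Y`: there is a quasi-compact open `U ⊆ f⁻¹(V)` with
`f(U) = V` and a finite affine open covering `U₁, …, U_r` of `U` such that the ring homomorphism
corresponding to `∐ i, U_i ⟶ V` is crisp. -/
def IsCrispOver (f : X ⟶ Y) (V : Y.Opens) : Prop :=
  ∃ U : X.Opens, IsCompact (U : Set X) ∧ U ≤ f ⁻¹ᵁ V ∧ f '' (U : Set X) = (V : Set Y) ∧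
    ∃ (r : ℕ) (W : Fin r → X.Opens) (hW : ∀ i, W i ≤ f ⁻¹ᵁ V),
      (∀ i, IsAffineOpen (W i)) ∧ ⨆ i, W i = U ∧ RingHomIsCrisp (sectionsMap f V W hW)

/-- A surjective morphism of quasi-separated schemes is crisp if it is locally quasi-compact
surjective and the target has an affine open covering over each member of which it is crisp. -/
structure IsCrisp (f : X ⟶ Y) : Prop where
  quasiSeparated_source : QuasiSeparatedSpace X
  quasiSeparated_target : QuasiSeparatedSpace Y
  isLocallyQuasiCompactSurjective : IsLocallyQuasiCompactSurjective f
  exists_cover : ∃ (J : Type u) (V : J → Y.Opens),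
    (∀ j, IsAffineOpen (V j)) ∧ ⨆ j, V j = ⊤ ∧ ∀ j, IsCrispOver f (V j)

/-- A subset of a scheme is ind-constructible if it is locally, that is on every affine open `U`,
a union of constructible subsets of `U`. -/
def IsIndConstructible (S : Set X) : Prop :=
  ∀ U : X.Opens, IsAffineOpen U →
    ∃ 𝒯 : Set (Set (U : Set X)), (∀ T ∈ 𝒯, IsConstructible T) ∧ ⋃₀ 𝒯 = (U : Set X) ↓∩ S

/-- The constructible topology on a scheme: the open sets are the ind-constructible sets. (On
schemes that are not quasi-separated it can differ from the topology generated by all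
quasi-compact opens and their complements.) -/
@[reducible]
def constructibleTopology (X : Scheme.{u}) : TopologicalSpace X where
  IsOpen S := IsIndConstructible S
  isOpen_univ := fun U _ ↦ ⟨{Set.univ}, by simp, by simp⟩
  isOpen_inter := by
    intro S S' hS hS' U hU
    obtain ⟨𝒯, h, e⟩ := hS U hU
    obtain ⟨𝒯', h', e'⟩ := hS' U hU
    refine ⟨Set.image2 (· ∩ ·) 𝒯 𝒯', ?_, ?_⟩
    · rintro _ ⟨T, hT, T', hT', rfl⟩
      exact (h T hT).inter (h' T' hT')
    · rw [Set.preimage_inter, ← e, ← e']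
      ext x
      simp only [Set.mem_sUnion, Set.mem_image2]
      constructor
      · rintro ⟨_, ⟨T, hT, T', hT', rfl⟩, hx, hx'⟩
        exact ⟨⟨T, hT, hx⟩, ⟨T', hT', hx'⟩⟩
      · rintro ⟨⟨T, hT, hx⟩, ⟨T', hT', hx'⟩⟩
        exact ⟨_, ⟨T, hT, T', hT', rfl⟩, hx, hx'⟩
  isOpen_sUnion := by
    intro 𝒮 h𝒮 U hU
    choose! 𝒯 h e using fun S hS ↦ h𝒮 S hS U hU
    refine ⟨⋃ S ∈ 𝒮, 𝒯 S, ?_, ?_⟩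
    · intro T hT
      obtain ⟨S, hS, hT⟩ := Set.mem_iUnion₂.mp hT
      exact h S hS T hT
    · rw [Set.preimage_sUnion]
      simp only [Set.sUnion_iUnion]
      exact Set.iUnion₂_congr e

/-- A morphism of schemes is submersive if it is surjective and the target carries the quotient
topology. -/
def IsSubmersive : MorphismProperty Scheme.{u} :=
  fun _ _ f ↦ IsQuotientMap f

/-- A morphism of schemes is subtrusive if every ordered pair of points (for the specialisation
order of the Zariski topology) of the target lifts to an ordered pair of points of the source, and
it is submersive for the constructible topologies. -/
def IsSubtrusive : MorphismProperty Scheme.{u} :=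
  fun X Y f ↦
    (∀ y y' : Y, y ⤳ y' → ∃ x x' : X, x ⤳ x' ∧ f x = y ∧ f x' = y') ∧
    @IsQuotientMap X Y (constructibleTopology X) (constructibleTopology Y) f

end Crisp

/-!
Crisp ring homomorphisms are stable under base change, and along a crisp `φ : A → B` every ideal
of `A` is contracted from `B`. This lifts a pair of primes `p ≤ p'` of `A` directly to `q ≤ q'`: it
suffices to find a prime `q'` over `p'` containing the contraction `t` of `p B_M`, where
`M = φ(A ∖ p)`, and `p'B + t` does not meet `φ(A ∖ p')` because the ideals `s p' + p` with `s ∉ p`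
are contracted. Hence specialisations lift along `Spec B → Spec A`, a closed subset of `Spec B`
saturated for this map has closed image, and the map is closed for the constructible topologies,
which are compact and Hausdorff. As open immersions are open for the Zariski and the constructible
topology alike, both quotient properties pass to any morphism through which such maps factor
locally on the target.
-/

namespace Crisp

section CommRing

variable {A B : Type u} [CommRing A] [CommRing B]

lemma ringHomIsCrisp_algebraMap_iff [Algebra A B] :
    RingHomIsCrisp (algebraMap A B) ↔
      ∀ (P : Type u) [AddCommGroup P] [Module A P],
        Function.Injective (TensorProduct.mk A B P 1) := by
  rw [RingHomIsCrisp, toAlgebra_algebraMap]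
  refine forall₃_congr fun P _ _ ↦ ?_
  have factor : TensorProduct.mk A B P 1 ∘ₗ (TensorProduct.lid A P).toLinearMap =
      (Algebra.linearMap A B).rTensor P := by
    ext
    simp
  rw [← factor, LinearMap.coe_comp, LinearEquiv.coe_coe, EquivLike.injective_comp]

lemma RingHomIsCrisp.isStableUnderBaseChange :
    RingHom.IsStableUnderBaseChange @RingHomIsCrisp.{u} := by
  intro A B A' B' _ _ _ _ _ _ _ _ _ _ _ _ h
  rw [ringHomIsCrisp_algebraMap_iff] at h ⊢
  intro P _ _
  let _ : Module A P := Module.compHom P (algebraMap A A')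
  have : IsScalarTower A A' P := .of_compHom A A' P
  have cancel : Algebra.IsPushout.cancelBaseChange A B A' B' P ∘ TensorProduct.mk A' B' P 1 =
      TensorProduct.mk A B P 1 :=
    funext (Algebra.IsPushout.cancelBaseChange_tmul A B A' B' P)
  exact .of_comp (cancel ▸ h P)

lemma RingHomIsCrisp.comap_map_le {φ : A →+* B} (h : RingHomIsCrisp φ) (I : Ideal A) :
    (I.map φ).comap φ ≤ I := by
  algebraize [φ]
  let j : B →ₐ[A] B ⊗[A] (A ⧸ I) := Algebra.TensorProduct.includeLeft
  have comm (a : A) : j (φ a) = 1 ⊗ₜ Ideal.Quotient.mk I a :=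
    (j.commutes a).trans (Algebra.TensorProduct.includeRight.commutes a).symm
  have map_le_ker : I.map φ ≤ RingHom.ker j := by
    refine Ideal.map_le_iff_le_comap.mpr fun a ha ↦ ?_
    rw [Ideal.mem_comap, RingHom.mem_ker, comm, Ideal.Quotient.eq_zero_iff_mem.mpr ha,
      TensorProduct.tmul_zero]
  intro a ha
  refine Ideal.Quotient.eq_zero_iff_mem.mp (ringHomIsCrisp_algebraMap_iff.mp h (A ⧸ I) ?_)
  rw [TensorProduct.mk_apply, map_zero, ← comm]
  exact map_le_ker ha

end CommRing

section LiftingPrimes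

variable {R S : Type*} [CommRing R] [CommRing S] {φ : R →+* S}

lemma disjoint_map_primeCompl_of_comap_map_le (h : ∀ I : Ideal R, (I.map φ).comap φ ≤ I)
    {p p' : Ideal R} [p.IsPrime] [p'.IsPrime] (hp : p ≤ p') {t : Ideal S}
    (ht : ∀ c ∈ t, ∃ s ∉ p, φ s * c ∈ p.map φ) :
    Disjoint ((p'.map φ ⊔ t : Ideal S) : Set S) (p'.primeCompl.map φ) := by
  rw [Set.disjoint_left]
  rintro _ hu ⟨u, hup', rfl⟩
  obtain ⟨a, ha, c, hc, hac⟩ := Submodule.mem_sup.mp hu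
  obtain ⟨s, hsp, hsc⟩ := ht c hc
  have hsu : s * u ∈ Ideal.span {s} * p' ⊔ p := by
    refine h _ ?_
    rw [Ideal.mem_comap, map_mul, ← hac, mul_add, Ideal.map_sup, Ideal.map_mul, Ideal.map_span,
      Set.image_singleton]
    exact Submodule.add_mem_sup (Ideal.mul_mem_mul (Ideal.mem_span_singleton_self _) ha) hsc
  obtain ⟨_, hsm, b, hb, hmb⟩ := Submodule.mem_sup.mp hsu
  obtain ⟨m, hm, rfl⟩ := Ideal.mem_span_singleton_mul.mp hsm
  have hsum : s * (u - m) ∈ p := by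
    rwa [mul_sub, ← hmb, add_sub_cancel_left]
  have hum : u - m ∈ p' := hp ((Ideal.IsPrime.mem_or_mem ‹_› hsum).resolve_left hsp)
  exact hup' ((Submodule.sub_mem_iff_left p' hm).mp hum)

lemma exists_le_comap_eq_of_comap_map_le (h : ∀ I : Ideal R, (I.map φ).comap φ ≤ I)
    {p p' : Ideal R} [p.IsPrime] [p'.IsPrime] (hp : p ≤ p') :
    ∃ q q' : Ideal S, q.IsPrime ∧ q'.IsPrime ∧ q ≤ q' ∧ q.comap φ = p ∧ q'.comap φ = p' := by
  let M := p.primeCompl.map φ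
  -- `t` is the contraction of `p S_M`, so `q'` contains some prime over `p` as soon as `t ≤ q'`.
  let t : Ideal S := ((p.map φ).map (algebraMap S (Localization M))).comap (algebraMap S _)
  have mem_t {c : S} : c ∈ t ↔ ∃ s ∉ p, φ s * c ∈ p.map φ := by
    simp [t, M, IsLocalization.algebraMap_mem_map_algebraMap_iff M]
  obtain ⟨q', hq', hle', hdisj'⟩ := Ideal.exists_le_prime_disjoint _ _
    (disjoint_map_primeCompl_of_comap_map_le h hp fun c ↦ mem_t.mp)
  have hdisj : Disjoint (p.map φ : Set S) (M ⊔ q'.primeCompl : Submonoid S) := by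
    rw [Set.disjoint_left]
    rintro _ hx hx'
    obtain ⟨_, ⟨s, hs, rfl⟩, c, hc, rfl⟩ := Submonoid.mem_sup.mp hx'
    exact hc (hle' (Ideal.mem_sup_right (mem_t.mpr ⟨s, hs, hx⟩)))
  obtain ⟨q, hq, hle, hdisj⟩ := Ideal.exists_le_prime_disjoint _ _ hdisj
  rw [Set.disjoint_left] at hdisj hdisj'
  refine ⟨q, q', hq, hq', fun x hx ↦ ?_, le_antisymm (fun x hx ↦ ?_) ?_,
    le_antisymm (fun x hx ↦ ?_) ?_⟩
  · by_contra hx'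
    exact hdisj hx (Submonoid.mem_sup_right hx')
  · by_contra hx'
    exact hdisj hx (Submonoid.mem_sup_left ⟨x, hx', rfl⟩)
  · exact Ideal.map_le_iff_le_comap.mp hle
  · by_contra hx'
    exact hdisj' hx ⟨x, hx', rfl⟩
  · exact Ideal.map_le_iff_le_comap.mp (le_sup_left.trans hle')

lemma exists_specializes_comap_eq_of_comap_map_le (h : ∀ I : Ideal R, (I.map φ).comap φ ≤ I)
    {p p' : PrimeSpectrum R} (hp : p ⤳ p') :
    ∃ q q' : PrimeSpectrum S, q ⤳ q' ∧ PrimeSpectrum.comap φ q = p ∧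
      PrimeSpectrum.comap φ q' = p' := by
  obtain ⟨q, q', hq, hq', hle, hqp, hqp'⟩ :=
    exists_le_comap_eq_of_comap_map_le h ((PrimeSpectrum.le_iff_specializes p p').mpr hp)
  exact ⟨⟨q, hq⟩, ⟨q', hq'⟩, (PrimeSpectrum.le_iff_specializes _ _).mp hle,
    PrimeSpectrum.ext hqp, PrimeSpectrum.ext hqp'⟩

lemma isQuotientMap_comap_of_exists_specializes
    (h : ∀ p p' : PrimeSpectrum R, p ⤳ p' → ∃ q q' : PrimeSpectrum S, q ⤳ q' ∧
      PrimeSpectrum.comap φ q = p ∧ PrimeSpectrum.comap φ q' = p') :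
    IsQuotientMap (PrimeSpectrum.comap φ) := by
  have surjective : Function.Surjective (PrimeSpectrum.comap φ) := fun p ↦
    let ⟨q, _, _, hq, _⟩ := h p p specializes_rfl
    ⟨q, hq⟩
  refine isQuotientMap_iff_isClosed.mpr ⟨surjective, fun T ↦
    ⟨fun hT ↦ hT.preimage (PrimeSpectrum.continuous_comap φ), fun hT ↦ ?_⟩⟩
  rw [← surjective.image_preimage T]
  refine PrimeSpectrum.isClosed_image_of_stableUnderSpecialization φ _ hT ?_
  rw [surjective.image_preimage T]
  intro p p' hp hpT
  obtain ⟨q, q', hq, rfl, rfl⟩ := h p p' hp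
  exact hT.stableUnderSpecialization hq hpT

lemma RingHomIsCrisp.exists_specializes_comap_eq {A B : Type u} [CommRing A] [CommRing B]
    {φ : A →+* B} (h : RingHomIsCrisp φ) {p p' : PrimeSpectrum A} (hp : p ⤳ p') :
    ∃ q q' : PrimeSpectrum B, q ⤳ q' ∧ PrimeSpectrum.comap φ q = p ∧
      PrimeSpectrum.comap φ q' = p' :=
  exists_specializes_comap_eq_of_comap_map_le h.comap_map_le hp

lemma RingHomIsCrisp.surjective_comap {A B : Type u} [CommRing A] [CommRing B] {φ : A →+* B}
    (h : RingHomIsCrisp φ) : Function.Surjective (PrimeSpectrum.comap φ) := fun p ↦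
  let ⟨q, _, _, hq, _⟩ := h.exists_specializes_comap_eq (specializes_refl p)
  ⟨q, hq⟩

end LiftingPrimes

section ConstructibleTopology

variable {X Y : Type*} [TopologicalSpace X] [TopologicalSpace Y]

lemma isOpen_constructibleTopology_of_isConstructible [CompactSpace X] {s : Set X}
    (hs : IsConstructible s) :
    IsOpen[_root_.constructibleTopology X] s ∧ IsOpen[_root_.constructibleTopology X] sᶜ := by
  induction hs using IsConstructible.empty_union_induction with
  | open_retrocompact U hU hU' =>
    refine ⟨hU'.isCompact.isOpen_constructibleTopology_of_isOpen hU,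
      IsCompact.isOpen_constructibleTopology_of_isClosed ?_ hU.isClosed_compl⟩
    rw [compl_compl]
    exact hU'.isCompact
  | union s _ t _ hs ht =>
    rw [Set.compl_union]
    exact ⟨@IsOpen.union X s t (_root_.constructibleTopology X) hs.1 ht.1,
      @IsOpen.inter X (_root_.constructibleTopology X) _ _ hs.2 ht.2⟩
  | compl s _ hs => exact ⟨hs.2, (compl_compl s).symm ▸ hs.1⟩

lemma isOpen_constructibleTopology_iff [CompactSpace X] [QuasiSeparatedSpace X] {s : Set X} :
    IsOpen[_root_.constructibleTopology X] s ↔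
      ∃ 𝒯 : Set (Set X), (∀ T ∈ 𝒯, IsConstructible T) ∧ ⋃₀ 𝒯 = s := by
  constructor
  · intro h
    have hb := @TopologicalSpace.isTopologicalBasis_of_subbasis X (_root_.constructibleTopology X)
      (constructibleTopologySubbasis X) rfl
    obtain ⟨𝒯, h𝒯, rfl⟩ := @TopologicalSpace.IsTopologicalBasis.open_eq_sUnion _
      (_root_.constructibleTopology X) _ hb _ h
    refine ⟨𝒯, fun T hT ↦ ?_, rfl⟩
    obtain ⟨F, ⟨hF, hF'⟩, rfl⟩ := h𝒯 hT
    refine IsConstructible.sInter hF fun T hT ↦ ?_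
    obtain ⟨ho, hc⟩ | ⟨ho, hc⟩ := hF' hT
    · exact hc.isConstructible ho
    · exact isConstructible_compl.mp (hc.isConstructible ho.isOpen_compl)
  · rintro ⟨𝒯, h𝒯, rfl⟩
    exact @isOpen_sUnion _ (_root_.constructibleTopology X) _
      fun T hT ↦ (isOpen_constructibleTopology_of_isConstructible (h𝒯 T hT)).1

lemma t2Space_constructibleTopology [T0Space X] [PrespectralSpace X] :
    @T2Space X (_root_.constructibleTopology X) := by
  refine @T2Space.mk _ (_) fun x y hxy ↦ ?_
  wlog h : ∃ U : Set X, IsOpen U ∧ x ∈ U ∧ y ∉ U generalizing x y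
  · obtain ⟨U, hU, h'⟩ := exists_isOpen_xor_mem hxy
    obtain ⟨V, W, hV, hW, hyV, hxW, hVW⟩ :=
      this y x hxy.symm ⟨U, hU, h'.resolve_left fun h' ↦ h ⟨U, hU, h'⟩⟩
    exact ⟨W, V, hW, hV, hxW, hyV, hVW.symm⟩
  obtain ⟨U, hU, hx, hy⟩ := h
  obtain ⟨V, ⟨hV, hV'⟩, hxV, hVU⟩ :=
    PrespectralSpace.isTopologicalBasis.exists_subset_of_mem_open hx hU
  refine ⟨V, Vᶜ, hV'.isOpen_constructibleTopology_of_isOpen hV,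
    IsCompact.isOpen_constructibleTopology_of_isClosed ?_ hV.isClosed_compl, hxV,
    fun h ↦ hy (hVU h), disjoint_compl_right⟩
  rwa [compl_compl]

lemma continuous_constructibleTopology_of_isSpectralMap {f : X → Y} (hf : IsSpectralMap f) :
    Continuous[_root_.constructibleTopology X, _root_.constructibleTopology Y] f := by
  refine (@continuous_generateFrom_iff _ _ (_) _ _).mpr ?_
  rintro s (⟨ho, hc⟩ | ⟨ho, hc⟩)
  · exact (hf.isCompact_preimage_of_isOpen ho hc).isOpen_constructibleTopology_of_isOpen
      (ho.preimage hf.continuous)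
  · refine IsCompact.isOpen_constructibleTopology_of_isClosed ?_ (ho.preimage hf.continuous)
    exact hf.isCompact_preimage_of_isOpen ho.isOpen_compl hc

lemma isQuotientMap_constructibleTopology_of_isSpectralMap [CompactSpace X] [QuasiSober X]
    [PrespectralSpace X] [QuasiSeparatedSpace X] [T0Space Y] [PrespectralSpace Y] {f : X → Y}
    (hf : IsSpectralMap f) (hs : Function.Surjective f) :
    @IsQuotientMap _ _ (_root_.constructibleTopology X) (_root_.constructibleTopology Y) f := by
  have hT2 : @T2Space Y (_root_.constructibleTopology Y) := t2Space_constructibleTopology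
  have hc : @CompactSpace X (_root_.constructibleTopology X) :=
    @Function.Surjective.compactSpace _ _ _ (_root_.constructibleTopology X) _
      (WithTopology.continuous_ofTopology _) _ (WithTopology.ofTopology_surjective _)
  have hcont := continuous_constructibleTopology_of_isSpectralMap hf
  exact @IsClosedMap.isQuotientMap _ _ _ (_root_.constructibleTopology X)
    (_root_.constructibleTopology Y) (@Continuous.isClosedMap _ _ (_root_.constructibleTopology X)
      (_root_.constructibleTopology Y) hc hT2 _ hcont) hcont hs

end ConstructibleTopology

section IndConstructible

variable {X Y : Scheme.{u}}

lemma exists_isAffineOpen_le_preimage (f : X ⟶ Y) {V : Y.Opens} {x : X} (hx : f x ∈ V) :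
    ∃ U : X.Opens, IsAffineOpen U ∧ x ∈ U ∧ U ≤ f ⁻¹ᵁ V :=
  exists_isAffineOpen_mem_and_subset (U := f ⁻¹ᵁ V) hx

lemma isConstructible_preimage [IsAffine X] [IsAffine Y] (f : X ⟶ Y) {T : Set Y}
    (hT : IsConstructible T) : IsConstructible (f ⁻¹' T) :=
  hT.preimage f.continuous fun _ hs hs' ↦
    (f.isSpectralMap.isCompact_preimage_of_isOpen hs hs'.isCompact).isRetrocompact
      (hs.preimage f.continuous)

lemma isConstructible_image [IsAffine X] [IsAffine Y] (j : X ⟶ Y) [IsOpenImmersion j] {T : Set X}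
    (hT : IsConstructible T) : IsConstructible (j '' T) :=
  hT.image_of_isOpenEmbedding j.isOpenEmbedding
    ((isCompact_range j.continuous).isRetrocompact j.isOpenEmbedding.isOpen_range)

lemma isIndConstructible_of_forall_exists {S : Set Y}
    (h : ∀ y ∈ S, ∃ (Z : Scheme.{u}) (_ : IsAffine Z) (j : Z ⟶ Y) (_ : IsOpenImmersion j)
      (T : Set Z), IsConstructible T ∧ y ∈ j '' T ∧ j '' T ⊆ S) :
    IsIndConstructible S := by
  intro U hU
  refine ⟨{T | IsConstructible T ∧ T ⊆ (U : Set Y) ↓∩ S}, fun T hT ↦ hT.1,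
    (Set.sUnion_subset fun T hT ↦ hT.2).antisymm ?_⟩
  rintro ⟨y, hyU⟩ hyS
  obtain ⟨Z, _, j, _, T, hT, ⟨z, hz, rfl⟩, hTS⟩ := h y hyS
  obtain ⟨W, hW, hzW, hWU⟩ := exists_isAffineOpen_le_preimage j hyU
  have : IsAffine U := hU
  have : IsAffine W := hW
  let k : W.toScheme ⟶ U.toScheme := j.resLE U W hWU
  have hk (w : W) : (k w).1 = j w.1 := congr($(j.resLE_comp_ι hWU) w)
  have : IsOpenImmersion (k ≫ U.ι) := by
    rw [j.resLE_comp_ι hWU]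
    infer_instance
  have : IsOpenImmersion k := .of_comp k U.ι
  refine ⟨k '' (W.ι ⁻¹' T), ⟨isConstructible_image k (isConstructible_preimage W.ι hT), ?_⟩,
    ⟨z, hzW⟩, hz, Subtype.ext (hk _)⟩
  rintro _ ⟨w, hw, rfl⟩
  exact (hk w ▸ hTS ⟨w.1, hw, rfl⟩ : (k w).1 ∈ S)

lemma IsIndConstructible.exists_isConstructible {S : Set Y} (hS : IsIndConstructible S) {y : Y}
    (hy : y ∈ S) :
    ∃ (V : Y.Opens) (hyV : y ∈ V) (T : Set V), IsAffineOpen V ∧ IsConstructible T ∧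
      ⟨y, hyV⟩ ∈ T ∧ V.ι '' T ⊆ S := by
  obtain ⟨V, hV, hyV, -⟩ := exists_isAffineOpen_mem_and_subset (TopologicalSpace.Opens.mem_top y)
  obtain ⟨𝒯, h𝒯, hun⟩ := hS V hV
  obtain ⟨T, hT, hyT⟩ : (⟨y, hyV⟩ : (V : Set Y)) ∈ ⋃₀ 𝒯 := hun ▸ hy
  refine ⟨V, hyV, T, hV, h𝒯 T hT, hyT, ?_⟩
  exact Set.image_subset_iff.mpr (hun ▸ Set.subset_sUnion_of_mem hT)

lemma continuous_constructibleTopology (f : X ⟶ Y) :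
    Continuous[constructibleTopology X, constructibleTopology Y] f := by
  refine @Continuous.mk _ _ (_) (_) _ fun S hS ↦ isIndConstructible_of_forall_exists fun x hx ↦ ?_
  obtain ⟨V, hxV, T, hV, hT, hxT, hTS⟩ := IsIndConstructible.exists_isConstructible hS hx
  obtain ⟨W, hW, hxW, hWV⟩ := exists_isAffineOpen_le_preimage f hxV
  have : IsAffine V := hV
  have : IsAffine W := hW
  let k : W.toScheme ⟶ V.toScheme := f.resLE V W hWV
  have hk (w : W) : V.ι (k w) = f w.1 := congr($(f.resLE_comp_ι hWV) w)
  refine ⟨W, hW, W.ι, inferInstance, k ⁻¹' T, isConstructible_preimage k hT,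
    ⟨⟨x, hxW⟩, ?_, rfl⟩, ?_⟩
  · have hkx : k ⟨x, hxW⟩ = ⟨f x, hxV⟩ := Subtype.ext (hk _)
    exact Set.mem_preimage.mpr (hkx ▸ hxT)
  · rintro _ ⟨w, hw, rfl⟩
    exact (hk w ▸ hTS ⟨_, hw, rfl⟩ : f w.1 ∈ S)

lemma isOpenMap_constructibleTopology (j : X ⟶ Y) [IsOpenImmersion j] :
    @IsOpenMap _ _ (constructibleTopology X) (constructibleTopology Y) j := by
  refine fun S hS ↦ isIndConstructible_of_forall_exists ?_
  rintro _ ⟨x, hx, rfl⟩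
  obtain ⟨V, hxV, T, hV, hT, hxT, hTS⟩ := IsIndConstructible.exists_isConstructible hS hx
  refine ⟨V, hV, V.ι ≫ j, inferInstance, T, hT, ⟨⟨x, hxV⟩, hxT, rfl⟩, ?_⟩
  rw [Scheme.Hom.comp_base, TopCat.coe_comp, Set.image_comp]
  exact Set.image_mono hTS

lemma constructibleTopology_eq_of_isAffine [IsAffine X] :
    constructibleTopology X = _root_.constructibleTopology X := by
  refine TopologicalSpace.ext_iff.mpr fun S ↦ ⟨fun hS ↦ ?_, fun hS ↦ ?_⟩
  · refine (@isOpen_iff_forall_mem_open X (_) S).mpr fun x hx ↦ ?_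
    obtain ⟨V, hxV, T, hV, hT, hxT, hTS⟩ := IsIndConstructible.exists_isConstructible hS hx
    have : IsAffine V := hV
    exact ⟨_, hTS, (isOpen_constructibleTopology_of_isConstructible
      (isConstructible_image V.ι hT)).1, ⟨⟨x, hxV⟩, hxT, rfl⟩⟩
  · obtain ⟨𝒯, h𝒯, rfl⟩ := isOpen_constructibleTopology_iff.mp hS
    refine isIndConstructible_of_forall_exists fun x ⟨T, hT, hxT⟩ ↦
      ⟨X, inferInstance, 𝟙 X, inferInstance, T, h𝒯 T hT, ⟨x, hxT, rfl⟩, ?_⟩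
    rintro _ ⟨t, ht, rfl⟩
    exact ⟨T, hT, ht⟩

end IndConstructible

section IsLocallyCrisp

variable {X Y : Scheme.{u}}

/-- A morphism `f : X ⟶ Y` is locally crisp if `Y` is covered by affine opens `Spec A` over which
some `Spec B ⟶ Spec A` coming from a crisp ring homomorphism factors through `f`. The
morphism `Spec B ⟶ X` is arbitrary, so that the notion is visibly stable under base change. -/
def IsLocallyCrisp : MorphismProperty Scheme.{u} :=
  fun X Y f ↦ ∀ y : Y, ∃ (A B : CommRingCat.{u}) (φ : A ⟶ B) (j : Spec A ⟶ Y) (g : Spec B ⟶ X),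
    IsOpenImmersion j ∧ y ∈ Set.range j ∧ RingHomIsCrisp φ.hom ∧ g ≫ f = Spec.map φ ≫ j

lemma exists_comp_eq_specMap_pi_comp_fromSpec {ι : Type u} [Finite ι] (f : X ⟶ Y) {V : Y.Opens}
    (hV : IsAffineOpen V) (W : ι → X.Opens) (hW : ∀ i, IsAffineOpen (W i))
    (h : ∀ i, W i ≤ f ⁻¹ᵁ V) :
    ∃ g : Spec (.of (∀ i, Γ(X, W i))) ⟶ X, g ≫ f =
      Spec.map (CommRingCat.ofHom (RingHom.pi fun i ↦ (f.appLE V (W i) (h i)).hom)) ≫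
        hV.fromSpec := by
  let p := sigmaSpec fun i ↦ Γ(X, W i)
  refine ⟨inv p ≫ Limits.Sigma.desc fun i ↦ (hW i).fromSpec, ?_⟩
  rw [← cancel_epi p, Category.assoc, IsIso.hom_inv_id_assoc]
  refine Limits.Sigma.hom_ext _ _ fun i ↦ ?_
  rw [Limits.Sigma.ι_desc_assoc, ι_sigmaSpec_assoc, ← Spec.map_comp_assoc,
    ← IsAffineOpen.SpecMap_appLE_fromSpec f hV (hW i) (h i)]
  rfl

lemma exists_comp_eq_specMap_sectionsMap_comp_fromSpec (f : X ⟶ Y) {V : Y.Opens}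
    (hV : IsAffineOpen V) {r : ℕ} (W : Fin r → X.Opens) (hW : ∀ i, IsAffineOpen (W i))
    (h : ∀ i, W i ≤ f ⁻¹ᵁ V) :
    ∃ g : Spec (.of (∀ i, Γ(X, W i))) ⟶ X,
      g ≫ f = Spec.map (CommRingCat.ofHom (sectionsMap f V W h)) ≫ hV.fromSpec := by
  -- `sigmaSpec` requires its index type to live in `Type u`.
  obtain ⟨g, hg⟩ := exists_comp_eq_specMap_pi_comp_fromSpec f hV
    (fun i : ULift.{u} (Fin r) ↦ W i.down) (fun i ↦ hW i.down) (fun i ↦ h i.down)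
  let ρ : (∀ i : ULift.{u} (Fin r), Γ(X, W i.down)) →+* (∀ i, Γ(X, W i)) :=
    RingHom.pi fun i ↦ Pi.evalRingHom (fun i : ULift.{u} (Fin r) ↦ Γ(X, W i.down)) ⟨i⟩
  refine ⟨Spec.map (CommRingCat.ofHom ρ) ≫ g, ?_⟩
  rw [Category.assoc, hg, ← Spec.map_comp_assoc]
  rfl

lemma IsCrisp.isLocallyCrisp {f : X ⟶ Y} (hf : IsCrisp f) : IsLocallyCrisp f := by
  obtain ⟨J, V, hV, htop, hcrisp⟩ := hf.exists_cover
  intro y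
  obtain ⟨j, hj⟩ : ∃ j, y ∈ V j := by
    rw [← TopologicalSpace.Opens.mem_iSup, htop]
    trivial
  obtain ⟨-, -, -, -, r, W, hW, hWa, -, hφ⟩ := hcrisp j
  obtain ⟨g, hg⟩ := exists_comp_eq_specMap_sectionsMap_comp_fromSpec f (hV j) W hWa hW
  exact ⟨_, _, _, (hV j).fromSpec, g, inferInstance, (hV j).range_fromSpec.symm ▸ hj, hφ, hg⟩

instance : IsLocallyCrisp.{u}.IsStableUnderBaseChange where
  of_isPullback {Y' X X' Y} i₂ f i₁ f' hp hf y' := by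
    obtain ⟨A, B, φ, j, g, _, hy, hφ, hg⟩ := hf (i₂ y')
    obtain ⟨W, hW, hyW, hWj⟩ := exists_isAffineOpen_le_preimage (V := j.opensRange) i₂ hy
    have range_le : Set.range (hW.fromSpec ≫ i₂) ⊆ Set.range j := by
      rw [Scheme.Hom.comp_base, TopCat.coe_comp, Set.range_comp, hW.range_fromSpec]
      exact Set.image_subset_iff.mpr hWj
    obtain ⟨ψ, hψ⟩ := Spec.map_surjective (IsOpenImmersion.lift j (hW.fromSpec ≫ i₂) range_le)
    have hψj : Spec.map ψ ≫ j = hW.fromSpec ≫ i₂ := by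
      rw [hψ, IsOpenImmersion.lift_fac]
    have := RingHom.isStableUnderCobaseChange_toMorphismProperty_iff.mpr
      RingHomIsCrisp.isStableUnderBaseChange.{u}
    let φ' := Limits.pushout.inl ψ φ
    let ψ' := Limits.pushout.inr ψ φ
    let g' := hp.lift (Spec.map ψ' ≫ g) (Spec.map φ' ≫ hW.fromSpec) <| by
      rw [Category.assoc, Category.assoc, hg, ← hψj, ← Spec.map_comp_assoc, ← Spec.map_comp_assoc,
        Limits.pushout.condition]
    refine ⟨_, _, φ', hW.fromSpec, g', inferInstance, hW.range_fromSpec.symm ▸ hyW, ?_,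
      hp.lift_snd _ _ _⟩
    exact MorphismProperty.pushout_inl (P := RingHom.toMorphismProperty RingHomIsCrisp) ψ φ hφ

lemma IsLocallyCrisp.surjective {f : X ⟶ Y} (hf : IsLocallyCrisp f) : Function.Surjective f := by
  intro y
  obtain ⟨A, B, φ, j, g, _, ⟨a, rfl⟩, hφ, hg⟩ := hf y
  obtain ⟨b, rfl⟩ := hφ.surjective_comap a
  exact ⟨g b, congr($hg b)⟩

lemma IsLocallyCrisp.exists_specializes {f : X ⟶ Y} (hf : IsLocallyCrisp f) {y y' : Y}
    (h : y ⤳ y') : ∃ x x' : X, x ⤳ x' ∧ f x = y ∧ f x' = y' := by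
  obtain ⟨A, B, φ, j, g, _, ⟨a', rfl⟩, hφ, hg⟩ := hf y'
  obtain ⟨a, rfl⟩ := h.mem_open j.isOpenEmbedding.isOpen_range ⟨a', rfl⟩
  obtain ⟨b, b', hb, rfl, rfl⟩ := hφ.exists_specializes_comap_eq
    (j.isOpenEmbedding.isInducing.specializes_iff.mp h)
  exact ⟨g b, g b', hb.map g.continuous, congr($hg b), congr($hg b')⟩

lemma IsLocallyCrisp.isQuotientMap {f : X ⟶ Y} (hf : IsLocallyCrisp f)
    (τ : ∀ Z : Scheme.{u}, TopologicalSpace Z)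
    (continuous : ∀ {Z W : Scheme.{u}} (g : Z ⟶ W), Continuous[τ Z, τ W] g)
    (isOpenMap : ∀ {Z W : Scheme.{u}} (j : Z ⟶ W) [IsOpenImmersion j],
      @IsOpenMap _ _ (τ Z) (τ W) j)
    (isQuotientMap_spec : ∀ {A B : CommRingCat.{u}} (φ : A ⟶ B), RingHomIsCrisp φ.hom →
      @IsQuotientMap _ _ (τ (Spec B)) (τ (Spec A)) (Spec.map φ)) :
    @IsQuotientMap X Y (τ X) (τ Y) f := by
  refine @IsQuotientMap.mk _ _ (_) (_) _ ((@isCoinducing_iff _ _ _ (_) (_)).mpr fun S ↦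
    ⟨fun hS ↦ ?_, (continuous f).isOpen_preimage S⟩) hf.surjective
  refine (@isOpen_iff_forall_mem_open Y (τ Y) S).mpr fun y hy ↦ ?_
  obtain ⟨A, B, φ, j, g, _, ⟨a, rfl⟩, hφ, hg⟩ := hf y
  refine ⟨j '' (j ⁻¹' S), Set.image_preimage_subset j S, isOpenMap j _ ?_, a, hy, rfl⟩
  have preimage_eq : Spec.map φ ⁻¹' (j ⁻¹' S) = g ⁻¹' (f ⁻¹' S) := by
    ext b
    exact congr($hg b ∈ S).to_iff.symm
  refine (@IsCoinducing.isOpen_preimage _ _ _ (_) (_)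
    (@IsQuotientMap.isCoinducing _ _ (_) (_) _ (isQuotientMap_spec φ hφ)) _).mp ?_
  exact preimage_eq ▸ (continuous g).isOpen_preimage _ hS

lemma IsLocallyCrisp.isSubmersive {f : X ⟶ Y} (hf : IsLocallyCrisp f) : IsSubmersive f :=
  hf.isQuotientMap (fun _ ↦ inferInstance) (fun g ↦ g.continuous)
    (fun j _ ↦ j.isOpenEmbedding.isOpenMap) fun _ hφ ↦
      isQuotientMap_comap_of_exists_specializes fun _ _ ↦ hφ.exists_specializes_comap_eq

lemma IsLocallyCrisp.isSubtrusive {f : X ⟶ Y} (hf : IsLocallyCrisp f) : IsSubtrusive f := by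
  refine ⟨fun _ _ ↦ hf.exists_specializes, hf.isQuotientMap constructibleTopology
    continuous_constructibleTopology isOpenMap_constructibleTopology fun φ hφ ↦ ?_⟩
  rw [constructibleTopology_eq_of_isAffine, constructibleTopology_eq_of_isAffine]
  exact isQuotientMap_constructibleTopology_of_isSpectralMap (Spec.map φ).isSpectralMap
    hφ.surjective_comap

end IsLocallyCrisp

end Crisp

theorem proposition2p18_general {X Y : Scheme.{u}} (f : X ⟶ Y) (hf : Crisp.IsLocallyCrisp f) :
    Crisp.IsSubtrusive.universally f ∧ Crisp.IsSubmersive.universally f := by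
  rw [← MorphismProperty.IsStableUnderBaseChange.universally_eq (P := Crisp.IsLocallyCrisp)] at hf
  exact ⟨MorphismProperty.universally_mono (fun _ _ _ ↦ Crisp.IsLocallyCrisp.isSubtrusive) _ hf,
    MorphismProperty.universally_mono (fun _ _ _ ↦ Crisp.IsLocallyCrisp.isSubmersive) _ hf⟩

theorem proposition2p18 {X Y : AlgebraicGeometry.Scheme.{u}} (f : X ⟶ Y)
    [AlgebraicGeometry.QuasiCompact f] (hf : Crisp.IsCrisp f) :
    Crisp.IsSubtrusive.universally f ∧ Crisp.IsSubmersive.universally f :=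
  proposition2p18_general f hf.isLocallyCrisp
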